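/- Let $(X,d)$ be a connected proper metric space (closed bounded sets are compact) and let $\mu$ be a Borel-regular measure on $X$ with $\mu(X)=\infty$ and $0<\mu(B(x,r))<\infty$ for every open ball $B(x,r)=\{y\in X: d(x,y)<r\}$, $x\in X$, $0<r<\infty$. A Borel function $g:X\to[0,\infty]$ is an upper gradient of $u:X\to[-\infty,\infty]$ if $|u(y)-u(x)|\le\int_\gamma g\,ds$ for every non-constant compact rectifiable curve $\gamma$ in $X$ with endpoints $x,y$, where this is read as $\int_\gamma g\,ds=\infty$ if $|u(x)|=\infty$ or $|u(y)|=\infty$, and where $\int_\gamma g\,ds$ is the integral with respect to arc length. For $1\le p<\infty$, the Dirichlet class $D^{1,p}(X)$ consists of the measurable functions $f:X\to\mathbb R$ that have an upper gradient $g$ with $\int_X g^p\,d\mu<\infty$. Let $1\le p<s<\infty$ and let $q>1$ satisfy $\frac1q+\frac1s=\frac1p$. Suppose that 1. $\mu$ is Ahlfors $s$-regular: there is a constant $C\ge1$ such that $C^{-1}r^s\le\mu(B(x,r))\le C\,r^s$ for all $x\in X$ and $0<r<2\operatorname{diam}(X)$; 2. $(X,d,\mu)$ is of globally $p$-controlled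 geometry: there are constants $C_d\ge1$ and $C,\lambda>0$ such that for all $x\in X$ and $0<r<\infty$ we have $\mu(B(x,2r))\le C_d\,\mu(B(x,r))$, and for every $u\in L^1_{\mathrm{loc}}(X)$ and every upper gradient $g$ of $u$, $$\frac1{\mu(B(x,r))}\int_{B(x,r)}|u-u_{B(x,r)}|\,d\mu\le C\,r\left(\frac1{\mu(B(x,\lambda r))}\int_{B(x,\lambda r)}g^p\,d\mu\right)^{1/p},$$ where $u_B=\frac1{\mu(B)}\int_B u\,d\mu$. Then for every $f\in D^{1,p}(X)$ there is a constant $c\in\mathbb R$ (which may depend on $f$) such that $f-c\in L^q(X)$, that is, $\int_X|f-c|^q\,d\mu<\infty$. -/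

import Mathlib

open MeasureTheory Set
open scoped ENNReal

noncomputable section

namespace Dirichlet

variable {X : Type*} [MetricSpace X]

/-- `γ`, restricted to the compact interval `[a, b]`, is a non-constant rectifiable curve in `X`. -/
structure IsRectifiableCurve (γ : ℝ → X) (a b : ℝ) : Prop where
  le : a ≤ b
  continuousOn : ContinuousOn γ (Icc a b)
  finite_length : eVariationOn γ (Icc a b) ≠ ∞
  nonconstant : ∃ t ∈ Icc a b, γ t ≠ γ a

/-- The path integral `∫_γ g ds` of a nonnegative function along the curve `γ : [a, b] → X`:
the integral over `[0, ℓ(γ)]` of `g` composed with the arc-length parametrization of `γ`. -/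
def pathIntegral (g : X → ℝ≥0∞) (γ : ℝ → X) (a b : ℝ) : ℝ≥0∞ :=
  ∫⁻ t in Icc 0 (eVariationOn γ (Icc a b)).toReal, g (naturalParameterization γ (Icc a b) a t)

/-- The Borel function `g : X → [0, ∞]` is an upper gradient of `u : X → [-∞, ∞]`.
In `EReal` every difference with at least one infinite term is infinite (also `⊤ - ⊤` and `⊥ - ⊥`),
so that the inequality then says that the path integral is infinite. -/
def IsUpperGradient [MeasurableSpace X] (u : X → EReal) (g : X → ℝ≥0∞) : Prop :=
  Measurable g ∧ ∀ (γ : ℝ → X) (a b : ℝ), IsRectifiableCurve γ a b →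
    (u (γ b) - u (γ a)).abs ≤ pathIntegral g γ a b

variable [MeasurableSpace X]

/-- The Dirichlet class `D^{1,p}(X)`. -/
def MemDirichlet (p : ℝ) (μ : Measure X) (f : X → ℝ) : Prop :=
  AEMeasurable f μ ∧
    ∃ g : X → ℝ≥0∞, IsUpperGradient (fun x => (f x : EReal)) g ∧ ∫⁻ x, g x ^ p ∂μ < ∞

/-- The extended real valued function `u` is in `L^1_loc(X)`. -/
def MemL1loc (μ : Measure X) (u : X → EReal) : Prop :=
  (∀ᵐ x ∂μ, u x ≠ ⊤ ∧ u x ≠ ⊥) ∧ LocallyIntegrable (fun x => (u x).toReal) μ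

/-- The global doubling property. -/
def IsGloballyDoubling (μ : Measure X) : Prop :=
  ∃ Cd : ℝ, 1 ≤ Cd ∧ ∀ (x : X) (r : ℝ), 0 < r →
    μ (Metric.ball x (2 * r)) ≤ ENNReal.ofReal Cd * μ (Metric.ball x r)

/-- The global `p`-Poincaré inequality, for all function-upper gradient pairs `(u, g)` with
`u` in `L^1_loc(X)`. -/
def SupportsGlobalPoincare (p : ℝ) (μ : Measure X) : Prop :=
  ∃ C lam : ℝ, 0 < C ∧ 0 < lam ∧ ∀ (x : X) (r : ℝ), 0 < r →
    ∀ (u : X → EReal) (g : X → ℝ≥0∞), MemL1loc μ u → IsUpperGradient u g →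
      ⨍⁻ y in Metric.ball x r,
          ‖(u y).toReal - ⨍ z in Metric.ball x r, (u z).toReal ∂μ‖ₑ ∂μ ≤
        ENNReal.ofReal (C * r) * (⨍⁻ y in Metric.ball x (lam * r), g y ^ p ∂μ) ^ (1 / p)

/-- Globally `p`-controlled geometry. -/
def IsGloballyControlled (p : ℝ) (μ : Measure X) : Prop :=
  IsGloballyDoubling μ ∧ SupportsGlobalPoincare p μ

/-- Ahlfors `s`-regularity: `C⁻¹ r ^ s ≤ μ (B(x, r)) ≤ C r ^ s` for `0 < r < 2 diam X`. -/
def IsAhlforsRegular (s : ℝ) (μ : Measure X) : Prop :=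
  ∃ C : ℝ, 1 ≤ C ∧ ∀ (x : X) (r : ℝ), 0 < r →
    ENNReal.ofReal r < 2 * Metric.ediam (univ : Set X) →
      ENNReal.ofReal (C⁻¹ * r ^ s) ≤ μ (Metric.ball x r) ∧
        μ (Metric.ball x r) ≤ ENNReal.ofReal (C * r ^ s)

end Dirichlet

end

/-! The proof is a weak type Sobolev inequality followed by Maz'ya's truncation argument.

Infinite measure makes `X` unbounded, so the Ahlfors bounds hold at every scale. By the Poincaré
inequality, averages of `u` over comparable balls at scale `R` differ by at most a constant times `R
^ (1 - s / p) * ‖g‖_p`. As `p < s`, the exponent is negative, so all ball averages tend to one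
constant `c` at infinity (`exists_tendsto_of_oscillation_le`). At a Lebesgue point, `u x - c`
telescopes over dyadic radii. Radii above a threshold `ρ` are controlled by the total energy, and
radii below `ρ` by the energy of small balls around `x`, provided it decays like `r ^ s`. A Vitali
covering shows that this proviso fails only on a set of measure `O(ρ ^ s)`. Optimizing in `ρ` gives
the weak type `(p, q)` estimate `BallGrowth.exists_weakSobolev`.

That estimate is for bounded functions, since `f` is not known to be locally integrable. A
compactness argument on the constants of the truncations of `f` produces `c` such that every set
`{|f - c| > t}` with `t > 0` has finite measure (`WeakSobolev.exists_measure_lt_top`). For the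
strong estimate, the weak one is applied to the dyadic truncations of `|f - c|`. Each has an upper
gradient living, up to a small error, on its own layer, so the energies are summable, and `q ≥ p`
allows summing their powers `q / p` (`WeakSobolev.lintegral_rpow_lt_top`). -/

namespace Dirichlet

open Filter Topology Metric

/-! ### Arc-length parametrization and upper gradients along subarcs -/

section Curves

variable {X : Type*} [MetricSpace X]

/-- The variation over a short interval on either side of a point tends to zero because `γ` is
continuous. With the intermediate value theorem, arc length then takes every value in `[0, ℓ(γ)]`,
so the natural parametrization has unit speed on that whole interval. -/
theorem continuousOn_variationOnFromTo {γ : ℝ → X} {a b : ℝ} (hγ : ContinuousOn γ (Icc a b))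
    (hV : BoundedVariationOn γ (Icc a b)) (ha : a ∈ Icc a b) :
    ContinuousOn (variationOnFromTo γ (Icc a b) a) (Icc a b) := by
  intro x hx
  have hl := hV.tendsto_eVariationOn_Icc_zero_left (x := x) ((hγ x hx).mono inter_subset_left)
  have hr := hV.tendsto_eVariationOn_Icc_zero_right x ((hγ x hx).mono inter_subset_left)
  have hsum := ((ENNReal.tendsto_toReal ENNReal.zero_ne_top).comp hl).add
    ((ENNReal.tendsto_toReal ENNReal.zero_ne_top).comp hr)
  simp only [ENNReal.toReal_zero, add_zero] at hsum
  rw [ContinuousWithinAt, tendsto_iff_dist_tendsto_zero]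
  refine squeeze_zero' (Eventually.of_forall fun _ => dist_nonneg) ?_ hsum
  filter_upwards [self_mem_nhdsWithin] with y hy
  rw [Real.dist_eq, variationOnFromTo.sub_right hV.locallyBoundedVariationOn ha hy hx]
  rcases le_total x y with h | h
  · rw [variationOnFromTo.eq_of_le _ _ h, abs_of_nonneg ENNReal.toReal_nonneg]
    exact le_add_of_nonneg_left ENNReal.toReal_nonneg
  · rw [variationOnFromTo.eq_of_ge _ _ h, abs_neg, abs_of_nonneg ENNReal.toReal_nonneg]
    exact le_add_of_nonneg_right ENNReal.toReal_nonneg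

theorem variationOnFromTo_Icc {γ : ℝ → X} {a b : ℝ} (hab : a ≤ b) :
    variationOnFromTo γ (Icc a b) a b = (eVariationOn γ (Icc a b)).toReal := by
  rw [variationOnFromTo.eq_of_le _ _ hab, inter_self]

theorem image_variationOnFromTo {γ : ℝ → X} {a b : ℝ} (hab : a ≤ b)
    (hγ : ContinuousOn γ (Icc a b)) (hV : BoundedVariationOn γ (Icc a b)) :
    variationOnFromTo γ (Icc a b) a '' Icc a b = Icc 0 (eVariationOn γ (Icc a b)).toReal := by
  have ha : a ∈ Icc a b := left_mem_Icc.2 hab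
  have hb : b ∈ Icc a b := right_mem_Icc.2 hab
  have hmono := variationOnFromTo.monotoneOn hV.locallyBoundedVariationOn ha
  apply Subset.antisymm
  · rintro _ ⟨t, ht, rfl⟩
    rw [← variationOnFromTo_Icc hab, ← variationOnFromTo.self γ (Icc a b) a]
    exact ⟨hmono ha ht ht.1, hmono ht hb ht.2⟩
  · have := intermediate_value_Icc hab (continuousOn_variationOnFromTo hγ hV ha)
    rwa [variationOnFromTo.self, variationOnFromTo_Icc hab] at this

theorem IsRectifiableCurve.hasUnitSpeedOn {γ : ℝ → X} {a b : ℝ} (h : IsRectifiableCurve γ a b) :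
    HasUnitSpeedOn (naturalParameterization γ (Icc a b) a)
      (Icc 0 (eVariationOn γ (Icc a b)).toReal) := by
  have hV : BoundedVariationOn γ (Icc a b) := h.finite_length
  rw [← image_variationOnFromTo h.le h.continuousOn hV]
  exact has_unit_speed_naturalParameterization γ hV.locallyBoundedVariationOn
    (left_mem_Icc.2 h.le)

theorem IsRectifiableCurve.naturalParameterization_left {γ : ℝ → X} {a b : ℝ}
    (h : IsRectifiableCurve γ a b) : naturalParameterization γ (Icc a b) a 0 = γ a := by
  have hV : BoundedVariationOn γ (Icc a b) := h.finite_length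
  have := edist_naturalParameterization_eq_zero hV.locallyBoundedVariationOn
    (left_mem_Icc.2 h.le) (left_mem_Icc.2 h.le)
  rwa [variationOnFromTo.self, edist_eq_zero] at this

theorem IsRectifiableCurve.naturalParameterization_right {γ : ℝ → X} {a b : ℝ}
    (h : IsRectifiableCurve γ a b) :
    naturalParameterization γ (Icc a b) a (eVariationOn γ (Icc a b)).toReal = γ b := by
  have hV : BoundedVariationOn γ (Icc a b) := h.finite_length
  have := edist_naturalParameterization_eq_zero hV.locallyBoundedVariationOn
    (left_mem_Icc.2 h.le) (right_mem_Icc.2 h.le)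
  rwa [variationOnFromTo_Icc h.le, edist_eq_zero] at this

theorem eVariationOn_of_hasUnitSpeedOn {γ : ℝ → X} {L s t : ℝ}
    (hγ : HasUnitSpeedOn γ (Icc 0 L)) (hs : 0 ≤ s) (hst : s ≤ t) (ht : t ≤ L) :
    eVariationOn γ (Icc s t) = ENNReal.ofReal (t - s) := by
  have := hγ (x := s) ⟨hs, hst.trans ht⟩ (y := t) ⟨hs.trans hst, ht⟩
  rwa [NNReal.coe_one, one_mul, inter_eq_self_of_subset_right (Icc_subset_Icc hs ht)] at this

theorem continuousOn_of_hasUnitSpeedOn {γ : ℝ → X} {L : ℝ} (hγ : HasUnitSpeedOn γ (Icc 0 L)) :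
    ContinuousOn γ (Icc 0 L) := by
  have hle : ∀ s ∈ Icc 0 L, ∀ t ∈ Icc 0 L, s ≤ t → dist (γ s) (γ t) ≤ dist s t := by
    intro s hs t ht hst
    have h1 := eVariationOn.edist_le γ (left_mem_Icc.2 hst) (right_mem_Icc.2 hst)
    rw [eVariationOn_of_hasUnitSpeedOn hγ hs.1 hst ht.2, edist_dist] at h1
    rw [dist_comm s t, Real.dist_eq, abs_of_nonneg (sub_nonneg.2 hst)]
    exact (ENNReal.ofReal_le_ofReal_iff (sub_nonneg.2 hst)).1 h1
  refine (LipschitzOnWith.of_dist_le_mul (K := 1) fun s hs t ht => ?_).continuousOn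
  rw [NNReal.coe_one, one_mul]
  rcases le_total s t with h | h
  · exact hle s hs t ht h
  · rw [dist_comm, dist_comm s]
    exact hle t ht s hs h

theorem naturalParameterization_of_hasUnitSpeedOn {γ : ℝ → X} {L s t τ : ℝ}
    (hγ : HasUnitSpeedOn γ (Icc 0 L)) (hs : 0 ≤ s) (ht : t ≤ L) (hτ : τ ∈ Icc 0 (t - s)) :
    naturalParameterization γ (Icc s t) s τ = γ (s + τ) := by
  have hst : s ≤ t := by linarith [hτ.1, hτ.2]
  have hmem : s + τ ∈ Icc s t := ⟨by linarith [hτ.1], by linarith [hτ.2]⟩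
  have hV : BoundedVariationOn γ (Icc s t) := by
    rw [BoundedVariationOn, eVariationOn_of_hasUnitSpeedOn hγ hs hst ht]
    exact ENNReal.ofReal_ne_top
  have h := edist_naturalParameterization_eq_zero hV.locallyBoundedVariationOn
    (left_mem_Icc.2 hst) hmem
  have hτ' : variationOnFromTo γ (Icc s t) s (s + τ) = τ := by
    rw [variationOnFromTo.eq_of_le _ _ hmem.1,
      inter_eq_self_of_subset_right (Icc_subset_Icc_right hmem.2),
      eVariationOn_of_hasUnitSpeedOn hγ hs hmem.1 (hmem.2.trans ht),
      ENNReal.toReal_ofReal (by linarith [hτ.1])]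
    ring
  rwa [hτ', edist_eq_zero] at h

theorem setLIntegral_Icc_comp_const_add (h : ℝ → ℝ≥0∞) (s t : ℝ) :
    ∫⁻ τ in Icc 0 (t - s), h (s + τ) = ∫⁻ τ in Icc s t, h τ := by
  have hpre : (fun τ => s + τ) ⁻¹' Icc s t = Icc 0 (t - s) := by
    simp [preimage_const_add_Icc]
  rw [← hpre]
  exact (measurePreserving_add_left volume s).setLIntegral_comp_preimage_emb
    (measurableEmbedding_addLeft s) h (Icc s t)

theorem isUpperGradient_coe_iff [MeasurableSpace X] {f : X → ℝ} {g : X → ℝ≥0∞} :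
    IsUpperGradient (fun x => (f x : EReal)) g ↔ Measurable g ∧ ∀ (γ : ℝ → X) (a b : ℝ),
      IsRectifiableCurve γ a b →
        ENNReal.ofReal |f (γ b) - f (γ a)| ≤ pathIntegral g γ a b := by
  simp only [IsUpperGradient, ← EReal.coe_sub, EReal.abs_def]

/-- A subarc of a unit-speed curve is its own natural parametrization up to a shift, and it is
non-constant when `s < t` since its length is `t - s`. The definition therefore localizes to every
subinterval. -/
theorem IsUpperGradient.le_setLIntegral [MeasurableSpace X] {f : X → ℝ} {g : X → ℝ≥0∞}
    (hg : IsUpperGradient (fun x => (f x : EReal)) g) {γ : ℝ → X} {L s t : ℝ}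
    (hγ : HasUnitSpeedOn γ (Icc 0 L)) (hs : 0 ≤ s) (hst : s ≤ t) (ht : t ≤ L) :
    ENNReal.ofReal |f (γ t) - f (γ s)| ≤ ∫⁻ τ in Icc s t, g (γ τ) := by
  rcases hst.eq_or_lt with rfl | hlt
  · simp
  have hvar := eVariationOn_of_hasUnitSpeedOn hγ hs hst ht
  have hcurve : IsRectifiableCurve γ s t := by
    refine ⟨hst, (continuousOn_of_hasUnitSpeedOn hγ).mono (Icc_subset_Icc hs ht),
      by rw [hvar]; exact ENNReal.ofReal_ne_top, ?_⟩
    by_contra! hcon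
    have h0 : eVariationOn γ (Icc s t) = 0 := by
      apply eVariationOn.constant_on
      rintro _ ⟨x, hx, rfl⟩ _ ⟨y, hy, rfl⟩
      rw [hcon x hx, hcon y hy]
    rw [hvar, ENNReal.ofReal_eq_zero] at h0
    linarith
  refine ((isUpperGradient_coe_iff.1 hg).2 γ s t hcurve).trans (le_of_eq ?_)
  rw [pathIntegral, hvar, ENNReal.toReal_ofReal (sub_nonneg.2 hst),
    ← setLIntegral_Icc_comp_const_add (fun τ => g (γ τ))]
  refine setLIntegral_congr_fun measurableSet_Icc fun τ hτ => ?_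
  rw [naturalParameterization_of_hasUnitSpeedOn hγ hs ht hτ]

end Curves

/-! ### Upper gradients of truncations -/

section Truncation

/-- This is absolute continuity of the integral of `h`. -/
theorem continuousOn_of_le_setLIntegral {v : ℝ → ℝ} {h : ℝ → ℝ≥0∞} {L : ℝ}
    (hfin : ∫⁻ τ in Icc 0 L, h τ ≠ ∞)
    (hv : ∀ s t, 0 ≤ s → s ≤ t → t ≤ L → ENNReal.ofReal |v t - v s| ≤ ∫⁻ τ in Icc s t, h τ) :
    ContinuousOn v (Icc 0 L) := by
  rw [Metric.continuousOn_iff]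
  intro b hb ε hε
  obtain ⟨δ, hδ, H⟩ := exists_pos_setLIntegral_lt_of_measure_lt hfin
    (ENNReal.ofReal_pos.2 hε).ne'
  have key : ∀ s t, 0 ≤ s → s ≤ t → t ≤ L → ENNReal.ofReal (t - s) < δ → |v t - v s| < ε := by
    intro s t hs hst ht hd
    have h1 : ∫⁻ τ in Icc s t, h τ ∂(volume.restrict (Icc 0 L)) < ENNReal.ofReal ε :=
      H _ ((Measure.restrict_apply_le _ _).trans_lt (by rwa [Real.volume_Icc]))
    rw [Measure.restrict_restrict measurableSet_Icc,
      inter_eq_self_of_subset_left (Icc_subset_Icc hs ht)] at h1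
    exact ((ENNReal.ofReal_lt_ofReal_iff hε).1 ((hv s t hs hst ht).trans_lt h1))
  obtain ⟨η, hη, hηδ⟩ : ∃ η : ℝ, 0 < η ∧ ENNReal.ofReal η ≤ δ := by
    rcases eq_or_ne δ ∞ with rfl | hne
    · exact ⟨1, one_pos, le_top⟩
    · exact ⟨δ.toReal, ENNReal.toReal_pos hδ.ne' hne, ENNReal.ofReal_toReal_le⟩
  refine ⟨η, hη, fun a ha hab => ?_⟩
  rw [Real.dist_eq] at hab ⊢
  rcases le_total a b with h | h
  · rw [abs_sub_comm] at hab ⊢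
    refine key a b ha.1 h hb.2 (lt_of_lt_of_le ?_ hηδ)
    exact (ENNReal.ofReal_lt_ofReal_iff hη).2 ((le_abs_self _).trans_lt hab)
  · refine key b a hb.1 h ha.2 (lt_of_lt_of_le ?_ hηδ)
    exact (ENNReal.ofReal_lt_ofReal_iff hη).2 ((le_abs_self _).trans_lt hab)

theorem clamp_increment_le_setLIntegral {v : ℝ → ℝ} {h k : ℝ → ℝ≥0∞} {L α β : ℝ} (hL : 0 ≤ L)
    (hcont : ContinuousOn v (Icc 0 L))
    (hv : ∀ s t, 0 ≤ s → s ≤ t → t ≤ L → ENNReal.ofReal |v t - v s| ≤ ∫⁻ τ in Icc s t, h τ)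
    (hk : ∀ τ ∈ Icc 0 L, α < v τ → v τ < β → h τ ≤ k τ) :
    ENNReal.ofReal (max α (min (v L) β) - max α (min (v 0) β)) ≤ ∫⁻ τ in Icc 0 L, k τ := by
  set lo := max α (min (v 0) β) with hlo
  set hi := max α (min (v L) β) with hhi
  rcases le_or_gt hi lo with hle | hlt
  · rw [ENNReal.ofReal_of_nonpos (sub_nonpos.2 hle)]
    exact zero_le
  have hαlo : α ≤ lo := le_max_left _ _
  have hhi' : hi = min (v L) β := by
    rcases max_choice α (min (v L) β) with h' | h' <;> [linarith; exact h']
  have hhiβ : hi ≤ β := hhi' ▸ min_le_right _ _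
  have hvL : hi ≤ v L := hhi' ▸ min_le_left _ _
  have hv0 : v 0 ≤ lo := by
    rcases min_choice (v 0) β with h' | h'
    · exact h'.ge.trans (le_max_right _ _)
    · have : β ≤ lo := by rw [hlo, h']; exact le_max_right _ _
      linarith
  -- `t₂` is the first time with `v ≥ hi`, and `t₁` the last time before it with `v ≤ lo`. Strictly
  -- between them `α < v < β`, so `h ≤ k` there.
  have hS : IsCompact (Icc 0 L ∩ v ⁻¹' Ici hi) :=
    isCompact_Icc.of_isClosed_subset (hcont.preimage_isClosed_of_isClosed isClosed_Icc isClosed_Ici)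
      inter_subset_left
  obtain ⟨t₂, ⟨ht₂, hvt₂⟩, hmin⟩ := hS.exists_isLeast ⟨L, right_mem_Icc.2 hL, hvL⟩
  have hcont' : ContinuousOn v (Icc 0 t₂) := hcont.mono (Icc_subset_Icc_right ht₂.2)
  have hS' : IsCompact (Icc 0 t₂ ∩ v ⁻¹' Iic lo) :=
    isCompact_Icc.of_isClosed_subset
      (hcont'.preimage_isClosed_of_isClosed isClosed_Icc isClosed_Iic) inter_subset_left
  obtain ⟨t₁, ⟨ht₁, hvt₁⟩, hmax⟩ := hS'.exists_isGreatest ⟨0, left_mem_Icc.2 ht₂.1, hv0⟩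
  simp only [mem_preimage, mem_Ici, mem_Iic] at hvt₁ hvt₂
  calc ENNReal.ofReal (hi - lo) ≤ ENNReal.ofReal |v t₂ - v t₁| :=
        ENNReal.ofReal_le_ofReal (by linarith [le_abs_self (v t₂ - v t₁)])
    _ ≤ ∫⁻ τ in Icc t₁ t₂, h τ := hv _ _ ht₁.1 ht₁.2 ht₂.2
    _ = ∫⁻ τ in Ioo t₁ t₂, h τ := setLIntegral_congr Ioo_ae_eq_Icc.symm
    _ ≤ ∫⁻ τ in Ioo t₁ t₂, k τ := by
        refine setLIntegral_mono' measurableSet_Ioo fun τ hτ => ?_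
        have hτ0 : 0 ≤ τ := ht₁.1.trans hτ.1.le
        have hτL : τ ≤ L := hτ.2.le.trans ht₂.2
        refine hk τ ⟨hτ0, hτL⟩ ?_ ?_
        · by_contra! hcon
          exact hτ.1.not_ge (hmax ⟨⟨hτ0, hτ.2.le⟩, hcon.trans hαlo⟩)
        · by_contra! hcon
          exact hτ.2.not_ge (hmin ⟨⟨hτ0, hτL⟩, hhiβ.trans hcon⟩)
    _ ≤ ∫⁻ τ in Icc 0 L, k τ :=
        lintegral_mono_set (Ioo_subset_Icc_self.trans (Icc_subset_Icc ht₁.1 ht₂.2))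

theorem abs_clamp_increment_le_setLIntegral {v : ℝ → ℝ} {h k : ℝ → ℝ≥0∞} {L α β : ℝ}
    (hL : 0 ≤ L) (hαβ : α ≤ β) (hcont : ContinuousOn v (Icc 0 L))
    (hv : ∀ s t, 0 ≤ s → s ≤ t → t ≤ L → ENNReal.ofReal |v t - v s| ≤ ∫⁻ τ in Icc s t, h τ)
    (hk : ∀ τ ∈ Icc 0 L, α < v τ → v τ < β → h τ ≤ k τ) :
    ENNReal.ofReal |max α (min (v L) β) - max α (min (v 0) β)| ≤ ∫⁻ τ in Icc 0 L, k τ := by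
  have hneg : ∀ x : ℝ, max (-β) (min (-x) (-α)) = -max α (min x β) := by
    intro x
    simp only [max_def, min_def]
    split_ifs <;> linarith
  rcases abs_choice (max α (min (v L) β) - max α (min (v 0) β)) with h' | h'
  · rw [h']
    exact clamp_increment_le_setLIntegral hL hcont hv hk
  · rw [h']
    -- The opposite sign follows by reflection: `-v` with levels `-β` and `-α`.
    have := clamp_increment_le_setLIntegral (v := fun t => -v t) (h := h) (k := k) (α := -β)
      (β := -α) hL hcont.neg
      (fun s t hs hst ht => by
        rw [neg_sub_neg, abs_sub_comm]; exact hv s t hs hst ht)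
      (fun τ hτ h1 h2 => hk τ hτ (by linarith) (by linarith))
    rw [hneg, hneg] at this
    convert this using 2
    ring

variable {X : Type*} [MetricSpace X] [MeasurableSpace X]

/-- The truncation of `f` at levels `α ≤ β` has the upper gradient `g 1_A + ε g`, for every
measurable `A ⊇ {α < f < β}`. The term `ε g` accounts for the curves on which `g` is not
integrable. -/
theorem IsUpperGradient.clamp [BorelSpace X] {f : X → ℝ} {g : X → ℝ≥0∞}
    (hg : IsUpperGradient (fun x => (f x : EReal)) g) {α β : ℝ} (hαβ : α ≤ β) {A : Set X}
    (hA : MeasurableSet A) (hsub : ∀ x, α < f x → f x < β → x ∈ A) {ε : ℝ≥0∞} (hε : ε ≠ 0) :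
    IsUpperGradient (fun x => ((max α (min (f x) β) : ℝ) : EReal))
      (fun x => A.indicator g x + ε * g x) := by
  have hgm := hg.1
  refine isUpperGradient_coe_iff.2 ⟨(hgm.indicator hA).add (hgm.const_mul ε), ?_⟩
  intro γ a b hγ
  have hunit := hγ.hasUnitSpeedOn
  rw [pathIntegral]
  set L := (eVariationOn γ (Icc a b)).toReal with hLdef
  have hL : 0 ≤ L := ENNReal.toReal_nonneg
  set Γ := naturalParameterization γ (Icc a b) a with hΓ
  have hΓ0 : Γ 0 = γ a := hγ.naturalParameterization_left
  have hΓL : Γ L = γ b := hγ.naturalParameterization_right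
  have hinc : ∀ s t, 0 ≤ s → s ≤ t → t ≤ L →
      ENNReal.ofReal |f (Γ t) - f (Γ s)| ≤ ∫⁻ τ in Icc s t, g (Γ τ) :=
    fun s t hs hst ht => hg.le_setLIntegral hunit hs hst ht
  have hmeas : AEMeasurable (fun τ => g (Γ τ)) (volume.restrict (Icc 0 L)) :=
    hgm.comp_aemeasurable
      ((continuousOn_of_hasUnitSpeedOn hunit).aemeasurable measurableSet_Icc)
  rcases eq_or_ne (∫⁻ τ in Icc 0 L, g (Γ τ)) ∞ with htop | hfin
  · refine le_top.trans (le_of_eq_of_le ?_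
      (lintegral_mono (f := fun τ => ε * g (Γ τ)) fun τ => le_add_self))
    rw [lintegral_const_mul'' _ hmeas, htop, ENNReal.mul_top hε]
  · rw [← hΓ0, ← hΓL]
    refine abs_clamp_increment_le_setLIntegral (v := fun t => f (Γ t)) hL hαβ
      (continuousOn_of_le_setLIntegral hfin hinc) hinc fun τ _ h1 h2 => ?_
    rw [indicator_of_mem (hsub _ h1 h2)]
    exact le_self_add

theorem IsUpperGradient.of_abs_sub_le {f u : X → ℝ} {g : X → ℝ≥0∞}
    (hg : IsUpperGradient (fun x => (f x : EReal)) g)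
    (h : ∀ x y, |u x - u y| ≤ |f x - f y|) : IsUpperGradient (fun x => (u x : EReal)) g := by
  rw [isUpperGradient_coe_iff] at hg ⊢
  exact ⟨hg.1, fun γ a b hγ => (ENNReal.ofReal_le_ofReal (h _ _)).trans (hg.2 γ a b hγ)⟩

end Truncation

/-! ### Oscillation of averages and the weak type estimate -/

section WeakType

variable {X : Type*} [MetricSpace X] [MeasurableSpace X] {μ : Measure X}

/-- Two-sided power bounds for the measure of all balls. -/
def BallGrowth (μ : Measure X) (s A : ℝ) : Prop :=
  ∀ (x : X) (r : ℝ), 0 < r →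
    ENNReal.ofReal (A⁻¹ * r ^ s) ≤ μ (ball x r) ∧ μ (ball x r) ≤ ENNReal.ofReal (A * r ^ s)

/-- The Poincaré inequality on all balls for a single pair `(u, g)`. -/
def PoincarePair (μ : Measure X) (p C lam : ℝ) (u : X → ℝ) (g : X → ℝ≥0∞) : Prop :=
  ∀ (x : X) (r : ℝ), 0 < r →
    ⨍⁻ y in ball x r, ‖u y - ⨍ z in ball x r, u z ∂μ‖ₑ ∂μ ≤
      ENNReal.ofReal (C * r) * (⨍⁻ y in ball x (lam * r), g y ^ p ∂μ) ^ (1 / p)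

/-- The constant in the oscillation estimate for averages. -/
noncomputable def oscConst (p s A C lam : ℝ) : ℝ :=
  A ^ 2 * 4 ^ s * C * (A * lam ^ (-s)) ^ (1 / p)

theorem oscConst_pos {p s A C lam : ℝ} (hA : 0 < A) (hC : 0 < C) (hlam : 0 < lam) :
    0 < oscConst p s A C lam := by
  unfold oscConst
  positivity

theorem oscConst_identity {p s A C lam R G : ℝ} (hA : 0 < A) (hlam : 0 < lam)
    (hR : 0 < R) (hG : 0 ≤ G) :
    (A⁻¹ * (R / 4) ^ s)⁻¹ * ((A * R ^ s) * (C * R * ((A⁻¹ * (lam * R) ^ s)⁻¹ * G) ^ (1 / p))) =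
      oscConst p s A C lam * R ^ (1 - s / p) * G ^ (1 / p) := by
  have h1 : (A⁻¹ * (lam * R) ^ s)⁻¹ = (A * lam ^ (-s)) * R ^ (-s) := by
    rw [Real.mul_rpow hlam.le hR.le, Real.rpow_neg hlam.le, Real.rpow_neg hR.le]
    field_simp
  have h2 : (R ^ (-s)) ^ (1 / p) * R = R ^ (1 - s / p) := by
    rw [← Real.rpow_mul hR.le, ← Real.rpow_add_one hR.ne']
    congr 1
    ring
  rw [h1, Real.mul_rpow (by positivity) hG, Real.mul_rpow (by positivity) (by positivity),
    Real.div_rpow hR.le (by norm_num), ← h2, oscConst]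
  have : R ^ s ≠ 0 := (Real.rpow_pos_of_pos hR s).ne'
  field_simp

theorem enorm_average_sub_le {X : Type*} [MeasurableSpace X] {μ : Measure X} {E : Set X}
    {u : X → ℝ} (hE0 : μ E ≠ 0) (hE : μ E ≠ ∞) (hu : IntegrableOn u E μ) (a : ℝ) :
    ‖(⨍ x in E, u x ∂μ) - a‖ₑ ≤ ⨍⁻ x in E, ‖u x - a‖ₑ ∂μ := by
  have hfin : IsFiniteMeasure (μ.restrict E) := ⟨by simpa using hE.lt_top⟩
  have hne : NeZero (μ.restrict E) := ⟨by simpa using hE0⟩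
  have hint : Integrable u ((μ.restrict E univ)⁻¹ • μ.restrict E) :=
    hu.smul_measure (by simpa using hE0)
  have h : (⨍ x in E, u x ∂μ) - a = ⨍ x in E, (u x - a) ∂μ := by
    rw [average, average, integral_sub hint (integrable_const a)]
    have := average_const (μ.restrict E) a
    rw [average] at this
    rw [this]
  rw [h, average, laverage]
  exact enorm_integral_le_lintegral_enorm _

theorem BallGrowth.measure_ball_pos {s A : ℝ} (hA : BallGrowth μ s A) (hA0 : 0 < A) (x : X)
    {r : ℝ} (hr : 0 < r) : 0 < μ (ball x r) :=
  (ENNReal.ofReal_pos.2 (by positivity)).trans_le (hA x r hr).1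

theorem BallGrowth.measure_ball_lt_top {s A : ℝ} (hA : BallGrowth μ s A) (x : X)
    {r : ℝ} (hr : 0 < r) : μ (ball x r) < ∞ :=
  (hA x r hr).2.trans_lt ENNReal.ofReal_lt_top

/-- Passing from the ball to `E` costs only the ratio of their measures, at most `A ^ 2 * 4 ^ s`,
because `E` contains a ball of radius `R / 4`. Allowing any such `E` covers closed balls with other
centers. -/
theorem abs_average_sub_average_ball_le [ProperSpace X] [BorelSpace X] {p s A C lam : ℝ}
    {u : X → ℝ} {g : X → ℝ≥0∞}
    (hp : 0 < p) (hA0 : 0 < A) (hC : 0 < C) (hlam : 0 < lam) (hA : BallGrowth μ s A)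
    (hu : LocallyIntegrable u μ) (hPI : PoincarePair μ p C lam u g) {y z : X} {R G : ℝ}
    (hR : 0 < R) {E : Set X} (hEB : E ⊆ ball y R) (hz : ball z (R / 4) ⊆ E) (hG0 : 0 ≤ G)
    (hG : ∫⁻ x in ball y (lam * R), g x ^ p ∂μ ≤ ENNReal.ofReal G) :
    |(⨍ x in E, u x ∂μ) - ⨍ x in ball y R, u x ∂μ| ≤
      oscConst p s A C lam * R ^ (1 - s / p) * G ^ (1 / p) := by
  set a := ⨍ x in ball y R, u x ∂μ with ha
  have hBpos := hA.measure_ball_pos hA0 y hR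
  have hBtop := hA.measure_ball_lt_top y hR
  have hEmeas : ENNReal.ofReal (A⁻¹ * (R / 4) ^ s) ≤ μ E :=
    (hA z (R / 4) (by positivity)).1.trans (measure_mono hz)
  have hE0 : μ E ≠ 0 :=
    ((ENNReal.ofReal_pos.2 (by positivity)).trans_le hEmeas).ne'
  have hEtop : μ E ≠ ∞ := ((measure_mono hEB).trans_lt hBtop).ne
  have huB : IntegrableOn u (closedBall y R) μ := hu.integrableOn_isCompact (isCompact_closedBall y R)
  have huE : IntegrableOn u E μ := huB.mono_set (hEB.trans ball_subset_closedBall)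
  have hlR : 0 < lam * R := by positivity
  have h1 : (⨍⁻ x in ball y (lam * R), g x ^ p ∂μ) ≤
      ENNReal.ofReal ((A⁻¹ * (lam * R) ^ s)⁻¹ * G) := by
    rw [setLAverage_eq, ENNReal.div_eq_inv_mul, ENNReal.ofReal_mul (by positivity),
      ENNReal.ofReal_inv_of_pos (by positivity)]
    exact mul_le_mul' (ENNReal.inv_le_inv.2 (hA y _ hlR).1) hG
  have h2 : ∫⁻ x in ball y R, ‖u x - a‖ₑ ∂μ ≤
      ENNReal.ofReal ((A * R ^ s) * (C * R * ((A⁻¹ * (lam * R) ^ s)⁻¹ * G) ^ (1 / p))) := by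
    rw [← measure_mul_setLAverage _ hBtop.ne, ENNReal.ofReal_mul (by positivity),
      ENNReal.ofReal_mul (p := C * R) (by positivity),
      ← ENNReal.ofReal_rpow_of_nonneg (p := 1 / p) (by positivity) (by positivity)]
    refine mul_le_mul' (hA y R hR).2 ((hPI y R hR).trans ?_)
    gcongr
  have h3 : ‖(⨍ x in E, u x ∂μ) - a‖ₑ ≤
      ENNReal.ofReal (oscConst p s A C lam * R ^ (1 - s / p) * G ^ (1 / p)) := by
    refine (enorm_average_sub_le hE0 hEtop huE a).trans ?_
    rw [← oscConst_identity hA0 hlam hR hG0, setLAverage_eq, ENNReal.div_eq_inv_mul,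
      ENNReal.ofReal_mul (by positivity), ENNReal.ofReal_inv_of_pos (by positivity)]
    exact mul_le_mul' (ENNReal.inv_le_inv.2 hEmeas) ((lintegral_mono_set hEB).trans h2)
  rw [Real.enorm_eq_ofReal_abs] at h3
  have hD := (oscConst_pos (p := p) (s := s) hA0 hC hlam).le
  exact (ENNReal.ofReal_le_ofReal_iff (by positivity)).1 h3

theorem dist_average_closedBall_le [ProperSpace X] [BorelSpace X] {p s A C lam : ℝ}
    {u : X → ℝ} {g : X → ℝ≥0∞}
    (hp : 0 < p) (hA0 : 0 < A) (hC : 0 < C) (hlam : 0 < lam) (hA : BallGrowth μ s A)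
    (hu : LocallyIntegrable u μ) (hPI : PoincarePair μ p C lam u g) {x x' y : X} {r r' R G : ℝ}
    (hR : 0 < R) (hx : closedBall x r ⊆ ball y R) (hx' : closedBall x' r' ⊆ ball y R)
    (hr : R / 4 ≤ r) (hr' : R / 4 ≤ r') (hG0 : 0 ≤ G)
    (hG : ∫⁻ x in ball y (lam * R), g x ^ p ∂μ ≤ ENNReal.ofReal G) :
    dist (⨍ z in closedBall x r, u z ∂μ) (⨍ z in closedBall x' r', u z ∂μ) ≤
      2 * (oscConst p s A C lam * R ^ (1 - s / p) * G ^ (1 / p)) := by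
  have h1 := abs_average_sub_average_ball_le hp hA0 hC hlam hA hu hPI hR hx
    ((ball_subset_ball hr).trans ball_subset_closedBall) hG0 hG
  have h2 := abs_average_sub_average_ball_le hp hA0 hC hlam hA hu hPI hR hx'
    ((ball_subset_ball hr').trans ball_subset_closedBall) hG0 hG
  rw [← Real.dist_eq] at h1 h2
  rw [two_mul]
  exact (dist_triangle_right _ _ _).trans (add_le_add h1 h2)

/-- Ball averages whose oscillation at scale `R` is `O(R ^ (-θ))` have a common limit. -/
theorem exists_tendsto_of_oscillation_le {X : Type*} [MetricSpace X] [Nonempty X]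
    {m : X → ℝ → ℝ} {K θ : ℝ} (hθ : 0 < θ)
    (h : ∀ (x x' y : X) (r r' R : ℝ), 0 < R → closedBall x r ⊆ ball y R →
      closedBall x' r' ⊆ ball y R → R / 4 ≤ r → R / 4 ≤ r' →
        dist (m x r) (m x' r') ≤ K * R ^ (-θ)) :
    ∃ c : ℝ, ∀ x, Tendsto (m x) atTop (𝓝 c) := by
  obtain ⟨x₀⟩ := ‹Nonempty X›
  have hpow : ∀ n : ℕ, ((2 : ℝ) ^ (n + 2)) ^ (-θ) = (4 : ℝ) ^ (-θ) * ((2 : ℝ) ^ (-θ)) ^ n := by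
    intro n
    rw [Real.rpow_pow_comm zero_le_two, ← Real.mul_rpow (by norm_num) (by positivity), pow_add]
    congr 1
    ring
  have hlt : (2 : ℝ) ^ (-θ) < 1 := Real.rpow_lt_one_of_one_lt_of_neg (by norm_num) (by linarith)
  have hb : ∀ n : ℕ, dist (m x₀ (2 ^ n)) (m x₀ (2 ^ (n + 1))) ≤
      (K * (4 : ℝ) ^ (-θ)) * ((2 : ℝ) ^ (-θ)) ^ n := by
    intro n
    have hn : (0 : ℝ) < 2 ^ n := by positivity
    rw [mul_assoc, ← hpow]
    refine h x₀ x₀ x₀ _ _ _ (by positivity) (closedBall_subset_ball ?_)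
      (closedBall_subset_ball ?_) ?_ ?_ <;> rw [pow_succ (2 : ℝ) (n + 1), pow_succ (2 : ℝ) n] <;>
      linarith
  obtain ⟨c, hc⟩ := cauchySeq_tendsto_of_complete (cauchySeq_of_le_geometric _ _ hlt hb)
  refine ⟨c, fun x => Metric.tendsto_atTop.2 fun ε hε => ?_⟩
  have hlim : Tendsto (fun n : ℕ => K * ((4 : ℝ) ^ (-θ) * ((2 : ℝ) ^ (-θ)) ^ n) +
      dist (m x₀ (2 ^ n)) c) atTop (𝓝 0) := by
    have h1 := ((tendsto_pow_atTop_nhds_zero_of_lt_one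
      (Real.rpow_nonneg zero_le_two (-θ)) hlt).const_mul ((4 : ℝ) ^ (-θ))).const_mul K
    have h2 := h1.add (tendsto_iff_dist_tendsto_zero.1 hc)
    simpa using h2
  obtain ⟨N, hN⟩ := eventually_atTop.1 (hlim.eventually_lt_const hε)
  refine ⟨max (2 ^ N) (dist x x₀), fun r hr => ?_⟩
  have hrN : (2 : ℝ) ^ N ≤ r := (le_max_left _ _).trans hr
  have hrd : dist x x₀ ≤ r := (le_max_right _ _).trans hr
  obtain ⟨n, hn1, hn2⟩ := exists_nat_pow_near ((one_le_pow₀ one_le_two).trans hrN)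
    (one_lt_two (α := ℝ))
  have hNn : N ≤ n :=
    Nat.lt_succ_iff.1 ((pow_lt_pow_iff_right₀ (one_lt_two (α := ℝ))).1 (hrN.trans_lt hn2))
  have hpos : (0 : ℝ) < 2 ^ n := by positivity
  -- Since `2 ^ n ≤ r < 2 ^ (n + 1)` and `dist x x₀ ≤ r`, both balls lie in the ball about `x₀` of
  -- radius `R = 2 ^ (n + 2)`, and both radii are at least `R / 4 = 2 ^ n`.
  refine (dist_triangle _ (m x₀ (2 ^ n)) _).trans_lt
    (lt_of_le_of_lt (add_le_add_left ?_ _) (hN n hNn))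
  rw [← hpow]
  rw [pow_succ] at hn2
  refine h x x₀ x₀ _ _ _ (by positivity) ?_ (closedBall_subset_ball ?_) ?_ ?_
  · refine (closedBall_subset_closedBall' (ε₂ := 2 * r) (by linarith)).trans
      (closedBall_subset_ball ?_)
    rw [pow_add]; linarith
  all_goals rw [pow_add]; linarith

theorem BallGrowth.isUnifLocDoublingMeasure {s A : ℝ} (hA : BallGrowth μ s A) (hA0 : 0 < A) :
    IsUnifLocDoublingMeasure μ := by
  refine ⟨⟨(A ^ 2 * 4 ^ s).toNNReal, ?_⟩⟩
  filter_upwards [self_mem_nhdsWithin] with ε hε x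
  have hε0 : (0 : ℝ) < ε := hε
  calc μ (closedBall x (2 * ε)) ≤ μ (ball x (4 * ε)) :=
        measure_mono (closedBall_subset_ball (by linarith))
    _ ≤ ENNReal.ofReal (A * (4 * ε) ^ s) := (hA x _ (by positivity)).2
    _ = ENNReal.ofReal (A ^ 2 * 4 ^ s) * ENNReal.ofReal (A⁻¹ * ε ^ s) := by
        rw [← ENNReal.ofReal_mul (by positivity), Real.mul_rpow (by norm_num) hε0.le]
        congr 1
        field_simp
    _ ≤ ENNReal.ofReal (A ^ 2 * 4 ^ s) * μ (closedBall x ε) := by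
        gcongr
        exact (hA x ε hε0).1.trans (measure_mono ball_subset_closedBall)

theorem BallGrowth.isLocallyFiniteMeasure {s A : ℝ} (hA : BallGrowth μ s A) :
    IsLocallyFiniteMeasure μ :=
  ⟨fun x => ⟨ball x 1, ball_mem_nhds x one_pos, hA.measure_ball_lt_top x one_pos⟩⟩

/-- A covering estimate: the points around which `h` has large integral on some ball. -/
theorem BallGrowth.measure_exists_lt_setLIntegral_le [ProperSpace X] [BorelSpace X] {s A : ℝ}
    (hs : 0 < s) (hA0 : 0 < A) (hA : BallGrowth μ s A) {h : X → ℝ≥0∞} {G ρ : ℝ} (hG : 0 < G) (hρ : 0 < ρ)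
    (hhG : ∫⁻ x, h x ∂μ ≤ ENNReal.ofReal G) :
    μ {x | ∃ r, 0 < r ∧ ENNReal.ofReal (G * (r / ρ) ^ s) < ∫⁻ y in ball x r, h y ∂μ} ≤
      ENNReal.ofReal (A * 10 ^ s * ρ ^ s) := by
  set t := {x | ∃ r, 0 < r ∧ ENNReal.ofReal (G * (r / ρ) ^ s) < ∫⁻ y in ball x r, h y ∂μ}
    with ht
  choose! r hr0 hr using fun x (hx : x ∈ t) => hx
  -- A ball of radius above `ρ` would carry more than the total energy `G`. Vitali's lemma needs
  -- such a bound on the radii.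
  have hrρ : ∀ x ∈ t, r x ≤ ρ := by
    intro x hx
    by_contra! hlt
    have h1 : (1 : ℝ) ≤ (r x / ρ) ^ s :=
      Real.one_le_rpow ((one_le_div hρ).2 hlt.le) hs.le
    have h2 : ENNReal.ofReal G ≤ ENNReal.ofReal (G * (r x / ρ) ^ s) :=
      ENNReal.ofReal_le_ofReal (le_mul_of_one_le_right hG.le h1)
    exact ((hr x hx).trans_le ((setLIntegral_le_lintegral _ _).trans (hhG.trans h2))).false
  obtain ⟨v, hvt, hdisj, hcov⟩ := Vitali.exists_disjoint_subfamily_covering_enlargement_closedBall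
    t (fun x => x) r ρ hrρ 5 (by norm_num)
  have hcount : v.Countable := hdisj.countable_of_nonempty_interior fun x hx =>
    ⟨x, ball_subset_interior_closedBall (mem_ball_self (hr0 x (hvt hx)))⟩
  have hball : ∀ x ∈ v, μ (closedBall x (5 * r x)) ≤
      ENNReal.ofReal (A * 10 ^ s * ρ ^ s / G) * ∫⁻ y in closedBall x (r x), h y ∂μ := by
    intro x hx
    have hrx := hr0 x (hvt hx)
    calc μ (closedBall x (5 * r x)) ≤ μ (ball x (10 * r x)) :=
          measure_mono (closedBall_subset_ball (by linarith))
      _ ≤ ENNReal.ofReal (A * (10 * r x) ^ s) := (hA x _ (by positivity)).2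
      _ = ENNReal.ofReal (A * 10 ^ s * ρ ^ s / G) * ENNReal.ofReal (G * (r x / ρ) ^ s) := by
          rw [← ENNReal.ofReal_mul (by positivity), Real.mul_rpow (by norm_num) hrx.le,
            Real.div_rpow hrx.le hρ.le]
          congr 1
          field_simp
      _ ≤ _ := by
          gcongr
          exact (hr x (hvt hx)).le.trans (lintegral_mono_set ball_subset_closedBall)
  calc μ t ≤ μ (⋃ x ∈ v, closedBall x (5 * r x)) := by
        refine measure_mono fun x hx => ?_
        obtain ⟨b, hb, hsub⟩ := hcov x hx
        exact mem_biUnion hb (hsub (mem_closedBall_self (hr0 x hx).le))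
    _ ≤ ∑' x : v, μ (closedBall (x : X) (5 * r x)) := measure_biUnion_le μ hcount _
    _ ≤ ∑' x : v, ENNReal.ofReal (A * 10 ^ s * ρ ^ s / G) *
          ∫⁻ y in closedBall (x : X) (r x), h y ∂μ :=
        ENNReal.tsum_le_tsum fun x => hball x x.2
    _ = ENNReal.ofReal (A * 10 ^ s * ρ ^ s / G) *
          ∫⁻ y in ⋃ x ∈ v, closedBall x (r x), h y ∂μ := by
        rw [ENNReal.tsum_mul_left,
          lintegral_biUnion hcount (fun x _ => measurableSet_closedBall) hdisj]
    _ ≤ ENNReal.ofReal (A * 10 ^ s * ρ ^ s / G) * ENNReal.ofReal G := by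
        gcongr
        exact (setLIntegral_le_lintegral _ _).trans hhG
    _ = ENNReal.ofReal (A * 10 ^ s * ρ ^ s) := by
        rw [← ENNReal.ofReal_mul' hG.le]
        congr 1
        field_simp

/-- The constant in the weak type estimate. -/
noncomputable def weakConst (p s A C lam : ℝ) : ℝ :=
  2 * oscConst p s A C lam / (1 - 2 ^ (1 - s / p)) + 8 * oscConst p s A C lam * lam ^ (s / p)

theorem weakConst_pos {p s A C lam : ℝ} (hp : 0 < p) (hps : p < s) (hA : 0 < A) (hC : 0 < C)
    (hlam : 0 < lam) : 0 < weakConst p s A C lam := by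
  have hD := oscConst_pos (p := p) (s := s) hA hC hlam
  have hlt : (2 : ℝ) ^ (1 - s / p) < 1 :=
    Real.rpow_lt_one_of_one_lt_of_neg (by norm_num) (by rw [sub_neg]; exact (one_lt_div hp).2 hps)
  have : 0 < 1 - (2 : ℝ) ^ (1 - s / p) := sub_pos.2 hlt
  unfold weakConst
  positivity

/-- Telescoping from radius `ρ` both ways gives two geometric series. Outward, the ratio is `2 ^ (1
- s / p) < 1`. Inward, the hypothesis `hx` turns `R ^ (1 - s / p)` into a multiple of `R`, so the
ratio is `1 / 2`. -/
theorem abs_sub_le_of_setLIntegral_le [ProperSpace X] [BorelSpace X] {p s A C lam : ℝ}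
    {u : X → ℝ} {g : X → ℝ≥0∞}
    (hp : 0 < p) (hps : p < s) (hA0 : 0 < A) (hC : 0 < C) (hlam : 0 < lam)
    (hA : BallGrowth μ s A) (hu : LocallyIntegrable u μ) (hPI : PoincarePair μ p C lam u g)
    {G ρ c : ℝ} {x : X} (hG : 0 < G) (hρ : 0 < ρ)
    (hgG : ∫⁻ x, g x ^ p ∂μ ≤ ENNReal.ofReal G)
    (hc : Tendsto (fun r => ⨍ z in closedBall x r, u z ∂μ) atTop (𝓝 c))
    (hleb : Tendsto (fun n : ℕ => ⨍ z in closedBall x (ρ * (1 / 2) ^ n), u z ∂μ) atTop (𝓝 (u x)))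
    (hx : ∀ r, 0 < r → ∫⁻ y in ball x r, g y ^ p ∂μ ≤ ENNReal.ofReal (G * (r / ρ) ^ s)) :
    |u x - c| ≤ weakConst p s A C lam * ρ ^ (1 - s / p) * G ^ (1 / p) := by
  have hD := oscConst_pos (p := p) (s := s) hA0 hC hlam
  set D := oscConst p s A C lam with hDdef
  set m : ℝ → ℝ := fun r => ⨍ z in closedBall x r, u z ∂μ with hm
  have hθ : 1 - s / p < 0 := by rw [sub_neg]; exact (one_lt_div hp).2 hps
  have hlt : (2 : ℝ) ^ (1 - s / p) < 1 := Real.rpow_lt_one_of_one_lt_of_neg (by norm_num) hθ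
  have hfwd : ∀ n : ℕ, dist (m (ρ * 2 ^ n)) (m (ρ * 2 ^ (n + 1))) ≤
      (2 * D * ρ ^ (1 - s / p) * G ^ (1 / p)) * ((2 : ℝ) ^ (1 - s / p)) ^ n := by
    intro n
    have hn : 0 < ρ * 2 ^ n := by positivity
    have hR : ρ * (2 : ℝ) ^ (n + 1) = 2 * (ρ * 2 ^ n) := by ring
    rw [hR]
    refine (dist_average_closedBall_le hp hA0 hC hlam hA hu hPI (R := 4 * (ρ * 2 ^ n)) (y := x)
      (by positivity) (closedBall_subset_ball (by linarith)) (closedBall_subset_ball (by linarith))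
      (by linarith) (by linarith) hG.le ((setLIntegral_le_lintegral _ _).trans hgG)).trans ?_
    have h4 : (4 : ℝ) ^ (1 - s / p) ≤ 1 :=
      Real.rpow_le_one_of_one_le_of_nonpos (by norm_num) hθ.le
    rw [Real.mul_rpow (by norm_num) hn.le, Real.mul_rpow hρ.le (by positivity),
      ← Real.rpow_pow_comm zero_le_two]
    calc 2 * (D * (4 ^ (1 - s / p) * (ρ ^ (1 - s / p) * (2 ^ (1 - s / p)) ^ n)) * G ^ (1 / p))
        = 4 ^ (1 - s / p) * (2 * D * ρ ^ (1 - s / p) * G ^ (1 / p) * (2 ^ (1 - s / p)) ^ n) := by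
          ring
      _ ≤ _ := mul_le_of_le_one_left (by positivity) h4
  have hbwd : ∀ n : ℕ, dist (m (ρ * (1 / 2) ^ n)) (m (ρ * (1 / 2) ^ (n + 1))) ≤
      (4 * D * lam ^ (s / p) * ρ ^ (1 - s / p) * G ^ (1 / p)) * (1 / 2 : ℝ) ^ n := by
    intro n
    set w := ρ * (1 / 2 : ℝ) ^ n with hw
    have hn : 0 < w := by positivity
    have hR : ρ * (1 / 2 : ℝ) ^ (n + 1) = w / 2 := by rw [hw, pow_succ]; ring
    rw [hR]
    have h2w : (0 : ℝ) < 2 * w := by positivity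
    refine (dist_average_closedBall_le hp hA0 hC hlam hA hu hPI (R := 2 * w) (y := x)
      (G := G * (lam * (2 * w) / ρ) ^ s)
      (by positivity) (closedBall_subset_ball (by linarith)) (closedBall_subset_ball (by linarith))
      (by linarith) (by linarith) (by positivity) (hx _ (by positivity))).trans (le_of_eq ?_)
    have e1 : (G * (lam * (2 * w) / ρ) ^ s) ^ (1 / p) =
        G ^ (1 / p) * (lam ^ (s / p) * (2 * w) ^ (s / p) / ρ ^ (s / p)) := by
      rw [Real.mul_rpow hG.le (by positivity), ← Real.rpow_mul (by positivity), mul_one_div,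
        Real.div_rpow (by positivity) hρ.le, Real.mul_rpow hlam.le h2w.le]
    have e2 : (2 * w) ^ (1 - s / p) * (2 * w) ^ (s / p) = 2 * w := by
      rw [← Real.rpow_add h2w, sub_add_cancel, Real.rpow_one]
    have e3 : ρ ^ (1 - s / p) = ρ / ρ ^ (s / p) := by
      rw [Real.rpow_sub hρ, Real.rpow_one]
    rw [e1, e3]
    calc 2 * (D * (2 * w) ^ (1 - s / p) *
          (G ^ (1 / p) * (lam ^ (s / p) * (2 * w) ^ (s / p) / ρ ^ (s / p))))
        = 2 * D * G ^ (1 / p) * lam ^ (s / p) / ρ ^ (s / p) *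
            ((2 * w) ^ (1 - s / p) * (2 * w) ^ (s / p)) := by ring
      _ = _ := by rw [e2, hw]; ring
  have h1 := dist_le_of_le_geometric_of_tendsto₀ _ _ hlt hfwd
    (hc.comp ((tendsto_pow_atTop_atTop_of_one_lt (one_lt_two (α := ℝ))).const_mul_atTop hρ))
  have h2 := dist_le_of_le_geometric_of_tendsto₀ _ _ (by norm_num : (1 / 2 : ℝ) < 1) hbwd hleb
  simp only [pow_zero, mul_one] at h1 h2
  rw [← Real.dist_eq]
  refine (dist_triangle_left _ _ (m ρ)).trans ((add_le_add h2 h1).trans (le_of_eq ?_))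
  rw [weakConst, ← hDdef]
  ring

theorem exists_weakType_bound [Nonempty X] [ProperSpace X] [BorelSpace X] {p s A C lam : ℝ}
    {u : X → ℝ} {g : X → ℝ≥0∞}
    (hp : 0 < p) (hps : p < s) (hA0 : 0 < A) (hC : 0 < C) (hlam : 0 < lam)
    (hA : BallGrowth μ s A) (hu : LocallyIntegrable u μ) (hPI : PoincarePair μ p C lam u g)
    {G : ℝ} (hG : 0 < G) (hgG : ∫⁻ x, g x ^ p ∂μ ≤ ENNReal.ofReal G) :
    ∃ c : ℝ, ∀ ρ, 0 < ρ →
      μ {x | weakConst p s A C lam * ρ ^ (1 - s / p) * G ^ (1 / p) < |u x - c|} ≤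
        ENNReal.ofReal (A * 10 ^ s * ρ ^ s) := by
  have hθ : 0 < s / p - 1 := sub_pos.2 ((one_lt_div hp).2 hps)
  obtain ⟨c, hc⟩ := exists_tendsto_of_oscillation_le (X := X)
    (m := fun x r => ⨍ z in closedBall x r, u z ∂μ)
    (K := 2 * oscConst p s A C lam * G ^ (1 / p)) hθ
    (by
      intro x x' y r r' R hR hx hx' hr hr'
      refine (dist_average_closedBall_le hp hA0 hC hlam hA hu hPI hR hx hx' hr hr' hG.le
        ((setLIntegral_le_lintegral _ _).trans hgG)).trans (le_of_eq ?_)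
      rw [neg_sub]
      ring)
  refine ⟨c, fun ρ hρ => ?_⟩
  have := hA.isUnifLocDoublingMeasure hA0
  have := hA.isLocallyFiniteMeasure
  refine le_trans (measure_mono_ae ?_)
    (hA.measure_exists_lt_setLIntegral_le (hp.trans hps) hA0 (h := fun x => g x ^ p) hG hρ
      hgG)
  filter_upwards [IsUnifLocDoublingMeasure.ae_tendsto_average (μ := μ) hu 1] with x hx hmem
  by_contra hcon
  have hcon' : ∀ r, 0 < r →
      ∫⁻ y in ball x r, g y ^ p ∂μ ≤ ENNReal.ofReal (G * (r / ρ) ^ s) := by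
    intro r hr
    by_contra! hlt
    exact hcon ⟨r, hr, hlt⟩
  have hlim : Tendsto (fun n : ℕ => ρ * (1 / 2 : ℝ) ^ n) atTop (𝓝[>] 0) := by
    refine tendsto_nhdsWithin_iff.2 ⟨?_, Eventually.of_forall fun n => ?_⟩
    · simpa using (tendsto_pow_atTop_nhds_zero_of_lt_one (by norm_num : (0 : ℝ) ≤ 1 / 2)
        (by norm_num)).const_mul ρ
    · exact mem_Ioi.2 (by positivity)
  refine not_lt_of_ge (abs_sub_le_of_setLIntegral_le hp hps hA0 hC hlam hA hu hPI hG hρ hgG (hc x)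
    (hx (fun _ => x) _ hlim (Eventually.of_forall fun n => ?_)) hcon') hmem
  exact mem_closedBall_self (by positivity)

end WeakType

/-! ### From weak type to strong type by truncation -/

section StrongType

variable {X : Type*} [MetricSpace X] [MeasurableSpace X] {μ : Measure X}

/-- The weak type `(p, q)` Sobolev inequality with constant `K`, up to additive constants, for
bounded functions. -/
def WeakSobolev (μ : Measure X) (p q K : ℝ) : Prop :=
  ∀ (u : X → ℝ) (M : ℝ) (g : X → ℝ≥0∞) (G : ℝ), AEMeasurable u μ → (∀ x, |u x| ≤ M) →
    IsUpperGradient (fun x => (u x : EReal)) g → 0 < G →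
    ∫⁻ x, g x ^ p ∂μ ≤ ENNReal.ofReal G →
      ∃ c : ℝ, ∀ t, 0 < t →
        μ {x | t < |u x - c|} ≤ ENNReal.ofReal (K * (G ^ (1 / p) / t) ^ q)

theorem BallGrowth.exists_weakSobolev [Nonempty X] [ProperSpace X] [BorelSpace X]
    {p q s A : ℝ} (hA : BallGrowth μ s A) (hA0 : 0 < A) (hp : 0 < p) (hps : p < s) (hq : 0 < q)
    (hpqs : 1 / q + 1 / s = 1 / p) (hPI : SupportsGlobalPoincare p μ) :
    ∃ K, 0 < K ∧ WeakSobolev μ p q K := by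
  obtain ⟨C, lam, hC, hlam, hPI⟩ := hPI
  have hW := weakConst_pos hp hps hA0 hC hlam
  set W := weakConst p s A C lam
  have hs : 0 < s := hp.trans hps
  have hθ : 0 < s / p - 1 := sub_pos.2 ((one_lt_div hp).2 hps)
  have hexp : 1 / (s / p - 1) * s = q := by
    have h1 : s / p - 1 = s / q := by
      rw [← mul_one_div s p, ← hpqs]
      field_simp
      ring
    rw [h1]
    field_simp
  refine ⟨A * 10 ^ s * W ^ q, by positivity, fun u M g G hum huM hg hG hgG => ?_⟩
  have := hA.isLocallyFiniteMeasure
  have hloc : LocallyIntegrable u μ :=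
    (locallyIntegrable_const M).mono hum.aestronglyMeasurable
      (Eventually.of_forall fun x => (huM x).trans (le_abs_self M))
  have hpair : PoincarePair μ p C lam u g := fun x r hr =>
    hPI x r hr (fun x => (u x : EReal)) g
      ⟨Eventually.of_forall fun x => ⟨EReal.coe_ne_top _, EReal.coe_ne_bot _⟩, hloc⟩ hg
  obtain ⟨c, hc⟩ := exists_weakType_bound hp hps hA0 hC hlam hA hloc hpair hG hgG
  refine ⟨c, fun t ht => ?_⟩
  have hGp : 0 < G ^ (1 / p) := by positivity
  have hz : 0 < W * G ^ (1 / p) / t := by positivity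
  -- This `ρ` solves `W * ρ ^ (1 - s / p) * G ^ (1 / p) = t`.
  have := hc ((W * G ^ (1 / p) / t) ^ (1 / (s / p - 1))) (by positivity)
  rw [← Real.rpow_mul hz.le, ← Real.rpow_mul hz.le, hexp,
    show 1 / (s / p - 1) * (1 - s / p) = -1 by
      rw [← neg_sub (s / p) 1, mul_neg, one_div_mul_cancel hθ.ne'], Real.rpow_neg_one] at this
  rw [show W * (W * G ^ (1 / p) / t)⁻¹ * G ^ (1 / p) = t by field_simp] at this
  refine this.trans (le_of_eq ?_)
  rw [mul_div_assoc, Real.mul_rpow hW.le (by positivity)]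
  congr 1
  ring

theorem abs_clamp_sub_clamp_le (α β a b : ℝ) :
    |max α (min a β) - max α (min b β)| ≤ |a - b| := by
  rw [max_comm α, max_comm α]
  exact (abs_max_sub_max_le_abs _ _ _).trans (by simpa using abs_min_sub_min_le_max a β b β)

theorem abs_clamp_neg_self_le {k : ℝ} (hk : 0 ≤ k) (a : ℝ) : |max (-k) (min a k)| ≤ k := by
  rw [abs_le]
  exact ⟨le_max_left _ _, max_le (by linarith) (min_le_right _ _)⟩

theorem clamp_eq_self {k a : ℝ} (h : |a| ≤ k) : max (-k) (min a k) = a := by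
  rw [min_eq_left (abs_le.1 h).2, max_eq_right (abs_le.1 h).1]

theorem abs_clamp_le_abs {k : ℝ} (hk : 0 ≤ k) (a : ℝ) : |max (-k) (min a k)| ≤ |a| := by
  have := abs_clamp_sub_clamp_le (-k) k a 0
  rwa [clamp_eq_self (a := 0) (by simpa using hk), sub_zero, sub_zero] at this

theorem aemeasurable_clamp {X : Type*} [MeasurableSpace X] {μ : Measure X} {f : X → ℝ} (hf : AEMeasurable f μ) (α β : ℝ) :
    AEMeasurable (fun x => max α (min (f x) β)) μ :=
  aemeasurable_const.max (hf.min aemeasurable_const)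

/-- A function with `p`-integrable upper gradient differs from some constant by a function whose
superlevel sets have finite measure. -/
theorem WeakSobolev.exists_measure_lt_top {p q K : ℝ} (hW : WeakSobolev μ p q K) (hq : 0 < q)
    {B : Set X} (hB0 : μ B ≠ 0) (hB : μ B ≠ ∞) {f : X → ℝ} {g : X → ℝ≥0∞} (hf : AEMeasurable f μ)
    (hg : IsUpperGradient (fun x => (f x : EReal)) g) {G : ℝ} (hG : 0 < G)
    (hgG : ∫⁻ x, g x ^ p ∂μ ≤ ENNReal.ofReal G) :
    ∃ c : ℝ, ∀ t, 0 < t → μ {x | t < |f x - c|} < ∞ := by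
  have hweak : ∀ k : ℕ, ∃ c : ℝ, ∀ t, 0 < t →
      μ {x | t < |max (-(k : ℝ)) (min (f x) k) - c|} ≤
        ENNReal.ofReal (K * (G ^ (1 / p) / t) ^ q) := fun k =>
    hW _ k g G (aemeasurable_clamp hf _ _) (fun x => abs_clamp_neg_self_le k.cast_nonneg _)
      (hg.of_abs_sub_le fun x y => abs_clamp_sub_clamp_le _ _ _ _) hG hgG
  choose c hc using hweak
  have hhalf : μ B / 2 < μ B := ENNReal.half_lt_self hB0 hB
  obtain ⟨t₀, ht₀, ht₀'⟩ : ∃ t₀ : ℝ, 0 < t₀ ∧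
      ENNReal.ofReal (K * (G ^ (1 / p) / t₀) ^ q) < μ B / 2 := by
    have h1 : Tendsto (fun t : ℝ => K * (G ^ (1 / p) / t) ^ q) atTop (𝓝 0) := by
      have := ((tendsto_const_nhds (x := G ^ (1 / p))).div_atTop tendsto_id).rpow_const
        (p := q) (Or.inr hq.le)
      simpa [Real.zero_rpow hq.ne'] using this.const_mul K
    have h2 := ENNReal.tendsto_ofReal h1
    rw [ENNReal.ofReal_zero] at h2
    have h3 := h2.eventually_lt_const (ENNReal.half_pos hB0)
    obtain ⟨t, ht, ht'⟩ := (h3.and (eventually_gt_atTop 0)).exists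
    exact ⟨t, ht', ht⟩
  have hmono : Monotone fun N : ℕ => {x | |f x| ≤ N} := fun a b hab x hx =>
    le_trans (b := (a : ℝ)) hx (by exact_mod_cast hab)
  have hunion : ⋃ N : ℕ, {x | |f x| ≤ N} = univ := by
    refine eq_univ_of_forall fun x => mem_iUnion.2 ?_
    exact exists_nat_ge |f x|
  obtain ⟨N, hN⟩ : ∃ N : ℕ, μ B / 2 < μ (B ∩ {x | |f x| ≤ N}) := by
    have := tendsto_measure_iUnion_atTop (μ := μ)
      (s := fun N : ℕ => B ∩ {x | |f x| ≤ N}) fun a b hab => inter_subset_inter_right _ (hmono hab)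
    rw [← inter_iUnion, hunion, inter_univ] at this
    exact (this.eventually_const_lt hhalf).exists
  -- More than half of `B` has `|f| ≤ N`, while the truncation is farther than `t₀` from `c k` on a
  -- set of measure less than half that of `B`. A point in the first set but not the second bounds
  -- `c k` independently of `k`.
  have hbdd : ∀ k, c k ∈ closedBall (0 : ℝ) (N + t₀) := by
    intro k
    have hne : ¬ (B ∩ {x | |f x| ≤ N} ⊆ {x | t₀ < |max (-(k : ℝ)) (min (f x) k) - c k|}) :=
      fun hsub => (((measure_mono hsub).trans (hc k t₀ ht₀)).trans_lt (ht₀'.trans hN)).false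
    obtain ⟨x, ⟨_, hxN⟩, hx⟩ := not_subset.1 hne
    rw [mem_ofPred_eq, not_lt] at hx
    have h1 := (abs_clamp_le_abs (k := k) k.cast_nonneg (f x)).trans hxN
    rw [mem_closedBall_zero_iff, Real.norm_eq_abs]
    rw [abs_le] at *
    constructor <;> linarith [h1.1, h1.2, hx.1, hx.2]
  obtain ⟨c₀, -, φ, hφ, hlim⟩ := tendsto_subseq_of_bounded isBounded_closedBall hbdd
  refine ⟨c₀, fun t ht => ?_⟩
  have htend := tendsto_measure_iUnion_atTop (μ := μ)
    (s := fun N : ℕ => {x | t < |f x - c₀|} ∩ {x | |f x| ≤ N})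
    fun a b hab => inter_subset_inter_right _ (hmono hab)
  rw [← inter_iUnion, hunion, inter_univ] at htend
  -- On `{|f| ≤ j}` the truncation at a level `φ i ≥ j` equals `f`. Once `c (φ i)` is within `t / 2`
  -- of `c₀`, the weak estimate at height `t / 2` gives a bound independent of `j`.
  refine lt_of_le_of_lt (le_of_tendsto' htend fun j => ?_)
    (ENNReal.ofReal_lt_top (r := K * (G ^ (1 / p) / (t / 2)) ^ q))
  obtain ⟨i, hi, hij⟩ := ((Metric.tendsto_nhds.1 hlim (t / 2) (half_pos ht)).and
    (eventually_ge_atTop j)).exists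
  refine (measure_mono ?_).trans (hc (φ i) (t / 2) (half_pos ht))
  rintro x ⟨hx, hxj⟩
  have hle : |f x| ≤ (φ i : ℝ) :=
    le_trans (b := (j : ℝ)) hxj (by exact_mod_cast hij.trans (hφ.id_le i))
  rw [mem_ofPred_eq, clamp_eq_self hle]
  rw [Function.comp_apply, Real.dist_eq] at hi
  have := abs_sub_le (f x) (c (φ i)) c₀
  rw [mem_ofPred_eq] at hx
  linarith

/-- Taking `ε ≤ 1` bounds the gradient by `2 * g` on `A`, whence the factor `2 ^ p`. Elsewhere it is
`ε * g`, whose energy is made at most `δ`. -/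
theorem exists_isUpperGradient_clamp [BorelSpace X] {p : ℝ} (hp : 1 ≤ p) {f : X → ℝ}
    {g : X → ℝ≥0∞} (hg : IsUpperGradient (fun x => (f x : EReal)) g)
    (hgp : ∫⁻ x, g x ^ p ∂μ ≠ ∞) {α β : ℝ} (hαβ : α ≤ β) {A : Set X} (hA : MeasurableSet A)
    (hsub : ∀ x, α < f x → f x < β → x ∈ A) {δ : ℝ≥0∞} (hδ : δ ≠ 0) :
    ∃ g', IsUpperGradient (fun x => ((max α (min (f x) β) : ℝ) : EReal)) g' ∧
      ∫⁻ x, g' x ^ p ∂μ ≤ 2 ^ p * ∫⁻ x in A, g x ^ p ∂μ + δ := by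
  have hp0 : 0 < p := by linarith
  obtain ⟨ε, hε0, hε1, hε⟩ : ∃ ε : ℝ≥0∞, ε ≠ 0 ∧ ε ≤ 1 ∧ ε ^ p * ∫⁻ x, g x ^ p ∂μ ≤ δ := by
    refine ⟨min 1 (δ / ∫⁻ x, g x ^ p ∂μ), ?_, min_le_left _ _, ?_⟩
    · simp [hδ, hgp]
    · have h1 : min 1 (δ / ∫⁻ x, g x ^ p ∂μ) ^ p ≤ δ / ∫⁻ x, g x ^ p ∂μ :=
        (ENNReal.rpow_le_self_of_le_one (min_le_left _ _) hp).trans (min_le_right _ _)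
      exact (mul_le_mul_left h1 _).trans (ENNReal.mul_div_le.trans' (mul_comm _ _).le)
  refine ⟨_, hg.clamp hαβ hA hsub hε0, ?_⟩
  rw [← lintegral_indicator hA, ← lintegral_const_mul' _ _ (by simp)]
  have hgm : Measurable fun x => g x ^ p := hg.1.pow_const p
  refine le_trans ?_ (add_le_add_right hε _)
  rw [← lintegral_const_mul _ hgm,
    ← lintegral_add_left ((hgm.indicator hA).const_mul _)]
  refine lintegral_mono fun x => ?_
  by_cases hx : x ∈ A
  · simp only [indicator_of_mem hx]
    refine le_trans ?_ le_self_add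
    rw [← ENNReal.mul_rpow_of_nonneg _ _ hp0.le]
    gcongr
    rw [two_mul]
    gcongr
    exact mul_le_of_le_one_left' hε1
  · simp only [indicator_of_notMem hx, zero_add, mul_zero]
    rw [ENNReal.mul_rpow_of_nonneg _ _ hp0.le]

theorem tsum_rpow_le_rpow_tsum {ι : Type*} (a : ι → ℝ≥0∞) {r : ℝ} (hr : 1 ≤ r) :
    ∑' i, a i ^ r ≤ (∑' i, a i) ^ r := by
  have hsplit : ∀ z : ℝ≥0∞, z ^ r = z ^ (r - 1) * z := by
    intro z
    conv_lhs => rw [← sub_add_cancel r 1]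
    rw [ENNReal.rpow_add_of_nonneg _ _ (sub_nonneg.2 hr) zero_le_one, ENNReal.rpow_one]
  rw [hsplit, ← ENNReal.tsum_mul_left]
  refine ENNReal.tsum_le_tsum fun i => ?_
  rw [hsplit]
  gcongr
  exact ENNReal.le_tsum i

/-- Truncation at a dyadic level turns the weak type inequality into a bound for a superlevel set
by the energy in the dyadic layer below it. -/
theorem WeakSobolev.measure_superlevel_le [BorelSpace X] {p q K : ℝ} (hp : 1 ≤ p)
    (hW : WeakSobolev μ p q K) (hμ : μ univ = ∞) {v : X → ℝ} {g : X → ℝ≥0∞}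
    (hv : AEMeasurable v μ) (hg : IsUpperGradient (fun x => (v x : EReal)) g)
    (hgp : ∫⁻ x, g x ^ p ∂μ ≠ ∞) {α : ℝ} (hα : 0 < α) (hfin : μ {x | α < v x} < ∞)
    {A : Set X} (hA : MeasurableSet A) (hsub : ∀ x, α < v x → v x < 2 * α → x ∈ A)
    {δ : ℝ≥0∞} (hδ : δ ≠ 0) (hδ' : δ ≠ ∞) :
    μ {x | 2 * α ≤ v x} ≤
      ENNReal.ofReal (K * ((2 ^ p * ∫⁻ x in A, g x ^ p ∂μ + δ).toReal ^ (1 / p) / (α / 2)) ^ q) := by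
  have hp0 : 0 < p := by linarith
  obtain ⟨g', hg', hg'G⟩ := exists_isUpperGradient_clamp hp hg hgp (by linarith : α ≤ 2 * α) hA
    hsub hδ
  set E := 2 ^ p * ∫⁻ x in A, g x ^ p ∂μ + δ with hE
  have hEtop : E ≠ ∞ := by
    refine ENNReal.add_ne_top.2 ⟨ENNReal.mul_ne_top (by simp) ?_, hδ'⟩
    exact ne_top_of_le_ne_top hgp (setLIntegral_le_lintegral _ _)
  have hE0 : 0 < E.toReal := ENNReal.toReal_pos (by simp [hE, hδ]) hEtop
  obtain ⟨c, hc⟩ := hW _ (2 * α) g' E.toReal (aemeasurable_clamp hv α (2 * α))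
    (fun x => by
      rw [abs_of_nonneg (hα.le.trans (le_max_left _ _))]
      exact max_le (by linarith) (min_le_right _ _)) hg' hE0
    (by rwa [ENNReal.ofReal_toReal hEtop])
  -- The truncation equals `α` off `{α < v}`, a set of infinite measure. The weak estimate would
  -- make that set finite in measure if `c` were another constant.
  have hcα : c = α := by
    by_contra hne
    have hpos : 0 < |α - c| := abs_pos.2 (sub_ne_zero.2 (Ne.symm hne))
    have h1 : {x | α < v x}ᶜ ⊆ {x | |α - c| / 2 < |max α (min (v x) (2 * α)) - c|} := by
      intro x hx
      rw [mem_compl_iff, mem_ofPred_eq, not_lt] at hx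
      rw [mem_ofPred_eq, max_eq_left ((min_le_left _ _).trans hx)]
      linarith
    have h2 : μ univ < ∞ := by
      rw [← union_compl_self {x | α < v x}]
      exact (measure_union_le _ _).trans_lt (ENNReal.add_lt_top.2 ⟨hfin,
        (measure_mono h1).trans_lt ((hc _ (half_pos hpos)).trans_lt ENNReal.ofReal_lt_top)⟩)
    exact h2.ne hμ
  refine (measure_mono fun x hx => ?_).trans (hc (α / 2) (half_pos hα))
  rw [mem_ofPred_eq] at hx ⊢
  rw [hcα, min_eq_right hx, max_eq_right (by linarith), abs_of_pos (by linarith)]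
  linarith

/-- The layers `S k` are disjoint, so their energies sum to at most the total. The errors `δ k` are
chosen summable, and `ℓ¹ ⊆ ℓ^(q/p)` because `q / p ≥ 1`. -/
theorem WeakSobolev.lintegral_rpow_lt_top [BorelSpace X] {p q K : ℝ} (hp : 1 ≤ p) (hpq : p ≤ q)
    (hK : 0 ≤ K) (hW : WeakSobolev μ p q K) (hμ : μ univ = ∞) {v : X → ℝ} {g : X → ℝ≥0∞}
    (hv0 : ∀ x, 0 ≤ v x) (hv : AEMeasurable v μ)
    (hg : IsUpperGradient (fun x => (v x : EReal)) g) (hgp : ∫⁻ x, g x ^ p ∂μ ≠ ∞)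
    (hfin : ∀ t, 0 < t → μ {x | t < v x} < ∞) :
    ∫⁻ x, ENNReal.ofReal (v x) ^ q ∂μ < ∞ := by
  have hp0 : 0 < p := by linarith
  have hq0 : 0 < q := by linarith
  set S : ℤ → Set X := fun k => {x | (2 : ℝ) ^ k < v x ∧ v x < 2 * 2 ^ k} with hS
  have hSnull : ∀ k, NullMeasurableSet (S k) μ := fun k =>
    hv.nullMeasurable (measurableSet_Ioo (a := (2 : ℝ) ^ k) (b := 2 * 2 ^ k))
  have hSdisj : Pairwise (Function.onFun (AEDisjoint μ) S) := by
    have hdisj : ∀ i j : ℤ, i < j → Disjoint (S i) (S j) := by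
      intro i j hij
      rw [Set.disjoint_left]
      rintro x ⟨-, h1⟩ ⟨h2, -⟩
      have : (2 : ℝ) ^ (i + 1) ≤ 2 ^ j := zpow_le_zpow_right₀ one_le_two hij
      rw [zpow_add_one₀ two_ne_zero] at this
      linarith
    intro i j hij
    rcases lt_or_gt_of_ne hij with h | h
    · exact (hdisj i j h).aedisjoint
    · exact (hdisj j i h).symm.aedisjoint
  obtain ⟨δ, hδ0, hδ⟩ := ENNReal.exists_pos_sum_of_countable (one_ne_zero (α := ℝ≥0∞)) ℤ
  set E : ℤ → ℝ≥0∞ := fun k => 2 ^ p * ∫⁻ x in S k, g x ^ p ∂μ + δ k with hE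
  have hEsum : ∑' k, E k < ∞ := by
    rw [hE, ENNReal.tsum_add, ENNReal.tsum_mul_left, ← lintegral_iUnion₀ hSnull hSdisj]
    refine ENNReal.add_lt_top.2 ⟨ENNReal.mul_lt_top (ENNReal.rpow_lt_top_of_nonneg hp0.le (by simp)) ?_,
      hδ.trans ENNReal.one_lt_top⟩
    exact (setLIntegral_le_lintegral _ _).trans_lt hgp.lt_top
  have hEtop : ∀ k, E k ≠ ∞ := fun k => ((ENNReal.le_tsum k).trans_lt hEsum).ne
  have hlevel : ∀ k : ℤ, ENNReal.ofReal (4 * 2 ^ k) ^ q * μ {x | 2 * 2 ^ k ≤ v x} ≤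
      ENNReal.ofReal (K * 8 ^ q) * E k ^ (q / p) := by
    intro k
    have hk : (0 : ℝ) < 2 ^ k := by positivity
    have h1 := hW.measure_superlevel_le hp hμ hv hg hgp hk (hfin _ hk)
      (measurableSet_toMeasurable μ (S k))
      (fun x h1 h2 => subset_toMeasurable μ (S k) ⟨h1, h2⟩)
      (δ := δ k) (by simpa using (hδ0 k).ne') ENNReal.coe_ne_top
    have hSfin : μ (S k) ≠ ∞ := ((measure_mono fun x hx => hx.1).trans_lt (hfin _ hk)).ne
    -- Since `v` is only a.e. measurable, the truncation used a measurable hull of the layer. The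
    -- hull gives the same restricted measure because the layer has finite measure.
    rw [Measure.restrict_toMeasurable hSfin] at h1
    refine (mul_le_mul_right h1 _).trans (le_of_eq ?_)
    change _ * ENNReal.ofReal (K * ((E k).toReal ^ (1 / p) / (2 ^ k / 2)) ^ q) = _
    obtain ⟨e, he0, he⟩ : ∃ e : ℝ, 0 ≤ e ∧ E k = ENNReal.ofReal e :=
      ⟨(E k).toReal, ENNReal.toReal_nonneg, (ENNReal.ofReal_toReal (hEtop k)).symm⟩
    rw [he, ENNReal.toReal_ofReal he0, ENNReal.ofReal_rpow_of_nonneg (by positivity) hq0.le,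
      ENNReal.ofReal_rpow_of_nonneg he0 (by positivity), ← ENNReal.ofReal_mul (by positivity),
      ← ENNReal.ofReal_mul (by positivity)]
    congr 1
    have h8 : (4 * (2 : ℝ) ^ k) ^ q * (e ^ (1 / p) / (2 ^ k / 2)) ^ q = 8 ^ q * e ^ (q / p) := by
      rw [← Real.mul_rpow (by positivity) (by positivity),
        show 4 * (2 : ℝ) ^ k * (e ^ (1 / p) / (2 ^ k / 2)) = 8 * e ^ (1 / p) by field_simp; ring,
        Real.mul_rpow (by norm_num) (by positivity), ← Real.rpow_mul he0]
      congr 2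
      ring
    rw [mul_left_comm, h8]
    ring
  have hTnull : ∀ k : ℤ, NullMeasurableSet {x | 2 * (2 : ℝ) ^ k ≤ v x} μ := fun k =>
    hv.nullMeasurable (measurableSet_Ici (a := 2 * (2 : ℝ) ^ k))
  calc ∫⁻ x, ENNReal.ofReal (v x) ^ q ∂μ
      ≤ ∫⁻ x, ∑' k : ℤ, {x | 2 * (2 : ℝ) ^ k ≤ v x}.indicator
          (fun _ => ENNReal.ofReal (4 * 2 ^ k) ^ q) x ∂μ := by
        refine lintegral_mono fun x => ?_
        rcases (hv0 x).eq_or_lt with h0 | h0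
        · rw [← h0, ENNReal.ofReal_zero, ENNReal.zero_rpow_of_pos hq0]
          exact zero_le
        · obtain ⟨n, hn1, hn2⟩ := exists_mem_Ico_zpow h0 (one_lt_two (α := ℝ))
          -- For `2 ^ n ≤ v x < 2 ^ (n + 1)`, the index `k = n - 1` gives `2 * 2 ^ k ≤ v x < 4 * 2 ^
          -- k`.
          refine le_trans ?_ (ENNReal.le_tsum (n - 1))
          have e1 : 2 * (2 : ℝ) ^ (n - 1) = 2 ^ n := by
            rw [zpow_sub_one₀ two_ne_zero]; ring
          rw [indicator_of_mem (by rw [mem_ofPred_eq, e1]; exact hn1)]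
          rw [zpow_add_one₀ two_ne_zero] at hn2
          gcongr
          linarith
    _ = ∑' k : ℤ, ENNReal.ofReal (4 * 2 ^ k) ^ q * μ {x | 2 * (2 : ℝ) ^ k ≤ v x} := by
        rw [lintegral_tsum fun k => aemeasurable_const.indicator₀ (hTnull k)]
        exact tsum_congr fun k => lintegral_indicator_const₀ (hTnull k) _
    _ ≤ ∑' k : ℤ, ENNReal.ofReal (K * 8 ^ q) * E k ^ (q / p) := ENNReal.tsum_le_tsum hlevel
    _ ≤ ENNReal.ofReal (K * 8 ^ q) * (∑' k, E k) ^ (q / p) := by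
        rw [ENNReal.tsum_mul_left]
        gcongr
        exact tsum_rpow_le_rpow_tsum E ((one_le_div hp0).2 hpq)
    _ < ∞ := ENNReal.mul_lt_top ENNReal.ofReal_lt_top
        (ENNReal.rpow_lt_top_of_nonneg (by positivity) hEsum.ne)

theorem ediam_univ_eq_top [Nonempty X] (hμ : μ univ = ∞)
    (hball : ∀ (x : X) (r : ℝ), 0 < r → μ (ball x r) < ∞) : ediam (univ : Set X) = ∞ := by
  by_contra hne
  obtain ⟨x⟩ := ‹Nonempty X›
  obtain ⟨r, hr⟩ := (isBounded_iff_ediam_ne_top.2 hne).subset_ball_lt 0 x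
  exact ((measure_mono hr.2).trans_lt (hball x r hr.1)).ne hμ

end StrongType

end Dirichlet

/-! ### The Sobolev embedding of the Dirichlet class -/

theorem mainTheorem12 {X : Type*} [MetricSpace X] [ProperSpace X] [ConnectedSpace X]
    [MeasurableSpace X] [BorelSpace X] (μ : MeasureTheory.Measure X)
    (hμ_univ : μ Set.univ = ⊤)
    (hμ_ball : ∀ (x : X) (r : ℝ), 0 < r →
      0 < μ (Metric.ball x r) ∧ μ (Metric.ball x r) < ⊤)
    (p q s : ℝ) (hp : 1 ≤ p) (hps : p < s) (hq : 1 < q) (hpqs : 1 / q + 1 / s = 1 / p)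
    (hAhlfors : Dirichlet.IsAhlforsRegular s μ)
    (hcontrolled : Dirichlet.IsGloballyControlled p μ)
    (f : X → ℝ) (hf : Dirichlet.MemDirichlet p μ f) :
    ∃ c : ℝ, MeasureTheory.MemLp (fun x => f x - c) (ENNReal.ofReal q) μ := by
  obtain ⟨A, hA1, hA⟩ := hAhlfors
  obtain ⟨hfm, g, hg, hgp⟩ := hf
  have hp0 : 0 < p := by linarith
  have hq0 : 0 < q := by linarith
  have hA0 : 0 < A := by linarith
  have hgrowth : Dirichlet.BallGrowth μ s A := fun x r hr => hA x r hr (by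
    rw [Dirichlet.ediam_univ_eq_top hμ_univ fun x r hr => (hμ_ball x r hr).2,
      ENNReal.mul_top two_ne_zero]
    exact ENNReal.ofReal_lt_top)
  have hpq : p ≤ q := by
    have h1 : 1 / q ≤ 1 / p := by
      rw [← hpqs]
      exact le_add_of_nonneg_right (by have := hp0.trans hps; positivity)
    exact (one_div_le_one_div hq0 hp0).1 h1
  obtain ⟨K, hK, hW⟩ := hgrowth.exists_weakSobolev hA0 hp0 hps hq0 hpqs hcontrolled.2
  obtain ⟨x₀⟩ : Nonempty X := inferInstance
  obtain ⟨hB0, hB⟩ := hμ_ball x₀ 1 one_pos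
  -- Adding `1` keeps the energy bound positive even when `g` vanishes almost everywhere.
  obtain ⟨c, hc⟩ := hW.exists_measure_lt_top hq0 hB0.ne' hB.ne hfm hg
    (G := (∫⁻ x, g x ^ p ∂μ).toReal + 1) (by positivity)
    ((ENNReal.ofReal_toReal hgp.ne).symm.le.trans (ENNReal.ofReal_le_ofReal (by linarith)))
  refine ⟨c, (hfm.sub_const c).aestronglyMeasurable, ?_⟩
  have hgv : Dirichlet.IsUpperGradient (fun x => ((|f x - c| : ℝ) : EReal)) g :=
    hg.of_abs_sub_le fun x y => by
      simpa using abs_abs_sub_abs_le_abs_sub (f x - c) (f y - c)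
  have hlt := hW.lintegral_rpow_lt_top hp hpq hK.le hμ_univ (fun x => abs_nonneg (f x - c))
    (continuous_abs.measurable.comp_aemeasurable (hfm.sub_const c)) hgv hgp.ne hc
  rw [eLpNorm_lt_top_iff_lintegral_rpow_enorm_lt_top (by simpa using hq0) ENNReal.ofReal_ne_top,
    ENNReal.toReal_ofReal hq0.le]
  simpa only [Real.enorm_eq_ofReal_abs] using hlt
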